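/- Let $p$ be a prime and let $\mathbf u=(u_n)_{n\ge 0}$ be a $p$-automatic sequence over a finite alphabet $\mathcal A$, i.e. there is a deterministic finite automaton with output which, on reading the base-$p$ digits of $n$ (least significant digit first), outputs $u_n$, for every $n\ge 0$. Let $\sigma$ be the left shift on $\mathcal A^{\mathbb N}$, where $\mathcal A$ is discrete and $\mathcal A^{\mathbb N}$ has the product topology, and let $X_{\mathbf u}=\overline{\{\sigma^n(\mathbf u):n\ge 0\}}\subseteq\mathcal A^{\mathbb N}$. Then there are a power $q=p^k$ with $k\ge 1$, an integer $d\ge 1$, a linear cellular automaton $\Phi:(\mathbb F_q^{\,d})^{\mathbb Z}\to(\mathbb F_q^{\,d})^{\mathbb Z}$ (a continuous, $\mathbb F_q$-linear map that commutes with the shift), and a configuration $R_0\in(\mathbb F_q^{\,d})^{\mathbb Z}$ that is eventually periodic in both directions, such that the closed set $Y=\overline{\{\Phi^n(R_0):n\ge 0\}}$ satisfies $\Phi(Y)\subseteq Y$ and $(X_{\mathbf u},\sigma)$ is a topological factor of $(Y,\Phi)$: there is a continuous surjection $\Psi:Y\to X_{\mathbf u}$ with $\Psi\circ\Phi=\sigma\circ\Psi$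 on $Y$. -/

import Mathlib

/-! ### Automatic sequences -/

/-- The base-`k` representation of `n` as a word over `{0, …, k - 1}`, least significant digit
first, without leading zeros (so the word of `0` is empty). Used for `k ≥ 2`. -/
def digitWord (k : ℕ) [NeZero k] (n : ℕ) : List (Fin k) :=
  (Nat.digits k n).map (Fin.ofNat k)

/-- A deterministic automaton with output, with input alphabet `{0, …, k - 1}`, states `S` and
output alphabet `A`. -/
structure DFAO (k : ℕ) (S A : Type*) where
  /-- the transition function -/
  step : S → Fin k → S
  /-- the initial state -/
  start : S
  /-- the output function -/
  output : S → A

/-- The output of the automaton after reading the word `w` from the initial state. -/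
def DFAO.eval {k : ℕ} {S A : Type*} (M : DFAO k S A) (w : List (Fin k)) : A :=
  M.output (w.foldl M.step M.start)

/-- `u` is `k`-automatic: it is generated by a DFAO with finitely many states that reads the
base-`k` representation of `n`. -/
def IsAutomatic (k : ℕ) [NeZero k] {A : Type*} (u : ℕ → A) : Prop :=
  ∃ (S : Type) (_ : Finite S) (M : DFAO k S A), ∀ n, u n = M.eval (digitWord k n)

/-! ### Configuration spaces -/

/-- The space of `M`-indexed configurations over the alphabet `A`. -/
def Config (M A : Type*) : Type _ := M → A

/-- The product topology, each copy of the alphabet being discrete. -/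
instance Config.instTopologicalSpace (M A : Type*) : TopologicalSpace (Config M A) :=
  @Pi.topologicalSpace M (fun _ => A) (fun _ => ⊥)

instance Config.instAddCommGroup (M A : Type*) [AddCommGroup A] : AddCommGroup (Config M A) :=
  inferInstanceAs (AddCommGroup (M → A))

instance Config.instModule (F M A : Type*) [Semiring F] [AddCommGroup A] [Module F A] :
    Module F (Config M A) :=
  inferInstanceAs (Module F (M → A))

/-- The left shift, `(σ R)(m) = R(m + 1)`. -/
def shift {M A : Type*} [Add M] [One M] (R : Config M A) : Config M A := fun m => R (m + 1)

theorem continuous_shift {M A : Type*} [Add M] [One M] :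
    Continuous (shift : Config M A → Config M A) :=
  @continuous_pi (Config M A) M (fun _ => A) _ (fun _ => ⊥) _
    fun m => @continuous_apply M (fun _ => A) (fun _ => ⊥) (m + 1)

/-- A bi-infinite configuration that is eventually periodic in both directions. -/
def IsEventuallyPeriodic {A : Type*} (R : Config ℤ A) : Prop :=
  (∃ a N : ℤ, 0 < a ∧ ∀ m, N ≤ m → R (m + a) = R m) ∧
  (∃ a N : ℤ, 0 < a ∧ ∀ m, m ≤ N → R (m - a) = R m)

/-! ### Cellular automata -/

/-- A one-dimensional cellular automaton: a continuous map that commutes with the shift. -/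
structure IsCellularAutomaton {A : Type*} (Φ : Config ℤ A → Config ℤ A) : Prop where
  continuous : Continuous Φ
  comm_shift : ∀ R, Φ (shift R) = shift (Φ R)

/-- A cellular automaton on an alphabet which is a vector space over `F` (in particular `F ^ d`)
is linear if it is an `F`-linear map. -/
structure IsLinearCellularAutomaton (F : Type*) [Field F] {A : Type*} [AddCommGroup A]
    [Module F A] (Φ : Config ℤ A → Config ℤ A) : Prop extends IsCellularAutomaton Φ where
  linear : IsLinearMap F Φ

/-! ### Topological dynamics -/

/-- A subsystem of `(X, T)`: a closed subset that `T` maps into itself. -/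
structure Subsystem {X : Type*} [TopologicalSpace X] (T : X → X) where
  carrier : Set X
  isClosed : IsClosed carrier
  mapsTo : Set.MapsTo T carrier carrier

/-- The map of a subsystem of `(X, T)`, the restriction of `T`. -/
def Subsystem.map {X : Type*} [TopologicalSpace X] {T : X → X} (Y : Subsystem T) :
    Y.carrier → Y.carrier :=
  Y.mapsTo.restrict

/-- The closure of the forward orbit `{T ^ n (x) : n ≥ 0}`. -/
def orbitClosure {X : Type*} [TopologicalSpace X] (T : X → X) (x : X) : Set X :=
  closure (Set.range fun n : ℕ => T^[n] x)

theorem mapsTo_orbitClosure {X : Type*} [TopologicalSpace X] {T : X → X} (hT : Continuous T)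
    (x : X) : Set.MapsTo T (orbitClosure T x) (orbitClosure T x) := by
  refine Set.MapsTo.closure ?_ hT
  rintro _ ⟨n, rfl⟩
  exact ⟨n + 1, Function.iterate_succ_apply' T n x⟩

/-- The one-sided subshift `X_u`, the orbit closure of `u` under the shift. -/
def subshift {A : Type*} (u : Config ℕ A) : Subsystem (shift : Config ℕ A → Config ℕ A) where
  carrier := orbitClosure shift u
  isClosed := isClosed_closure
  mapsTo := mapsTo_orbitClosure continuous_shift u

/-- `(X, S)` is a topological factor of `(Y, T)`. -/
def IsTopologicalFactor {X Y : Type*} [TopologicalSpace X] [TopologicalSpace Y]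
    (S : X → X) (T : Y → Y) : Prop :=
  ∃ Ψ : Y → X, Continuous Ψ ∧ Function.Surjective Ψ ∧ ∀ y, Ψ (T y) = S (Ψ y)

open Polynomial

/-! For each letter `c`, let `f` in F_p[[x]] be the indicator series of the positions of `c` in `u`.
By Christol's argument `f` satisfies an additive equation `∑ a i * f ^ p ^ i = 0`, and Cartier
operators make it separable, `a 0 ≠ 0` (`exists_additive_equation`,
`exists_separable_additive_equation`).

In the spirit of Furstenberg, separability makes `f` the coefficient of `y⁻¹` in a rational function
of `x` and `y` whose denominator, at `x = 0`, is a unit of F_p[y, y⁻¹]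
(`isRationalResidue_of_additive_equation`). After normalisation, a common denominator for all
letters is `1 - x * Q`. The `x`-coefficients of its inverse obey a linear recurrence over F_p[y,
y⁻¹]. Since multiplication by a Laurent polynomial is a linear cellular automaton, the recurrence
becomes one once finitely many past rows are stored (`exists_linearCA_of_isRationalResidue`).

Thus `u n` is a function of a finite window of the `n`-th iterate, and compactness turns this into a
factor map (`exists_isTopologicalFactor_subshift`). -/

/-! ### Finite windows and factors of orbit closures -/

theorem continuous_of_finite_window {M V B : Type*} [TopologicalSpace B] (f : Config M V → B)
    (s : Finset M) (h : ∀ R R' : Config M V, (∀ m ∈ s, R m = R' m) → f R = f R') :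
    Continuous f := by
  refine IsLocallyConstant.continuous ((IsLocallyConstant.iff_exists_open f).2 fun R => ?_)
  refine ⟨⋂ m ∈ s, (fun R' : Config M V => R' m) ⁻¹' {R m}, isOpen_biInter_finset fun m _ => ?_,
    by simp, fun R' hR' => h _ _ fun m hm => ?_⟩
  · let : TopologicalSpace V := ⊥
    have : DiscreteTopology V := ⟨rfl⟩
    exact (isOpen_discrete _).preimage (continuous_apply (A := fun _ : M => V) m)
  · simp only [Set.mem_iInter, Set.mem_preimage, Set.mem_singleton_iff] at hR'
    exact hR' m hm

theorem Config.continuous_iff {X M V : Type*} [TopologicalSpace X] {f : X → Config M V} :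
    Continuous f ↔ ∀ m, @Continuous X V _ ⊥ fun x => f x m := by
  let : TopologicalSpace V := ⊥
  exact continuous_pi_iff (A := fun _ : M => V)

instance Config.instCompactSpace (M V : Type*) [Finite V] : CompactSpace (Config M V) := by
  let : TopologicalSpace V := ⊥
  exact inferInstanceAs (CompactSpace (M → V))

instance Config.instT2Space (M V : Type*) : T2Space (Config M V) := by
  let : TopologicalSpace V := ⊥
  have : DiscreteTopology V := ⟨rfl⟩
  exact inferInstanceAs (T2Space (M → V))

/-- A sequence that is read off an orbit through a finite window generates a factor of the orbit
closure. -/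
theorem exists_isTopologicalFactor_subshift {M V A : Type*} [Finite V]
    {Φ : Config M V → Config M V} (hΦ : Continuous Φ) (R₀ : Config M V) (out : Config M V → A)
    (s : Finset M) (hout : ∀ R R' : Config M V, (∀ m ∈ s, R m = R' m) → out R = out R')
    (u : Config ℕ A) (hu : ∀ n, out (Φ^[n] R₀) = u n) :
    ∃ Y : Subsystem Φ, Y.carrier = orbitClosure Φ R₀ ∧
      IsTopologicalFactor (subshift u).map Y.map := by
  let Ψ : Config M V → Config ℕ A := fun R n => out (Φ^[n] R)
  have hΨ : Continuous Ψ := by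
    refine Config.continuous_iff.2 fun n => ?_
    let : TopologicalSpace A := ⊥
    exact (continuous_of_finite_window out s hout).comp (hΦ.iterate n)
  have hcomm (R : Config M V) : Ψ (Φ R) = shift (Ψ R) := rfl
  have hiter (n : ℕ) : Ψ (Φ^[n] R₀) = shift^[n] u := by
    induction n with
    | zero => exact funext hu
    | succ n ih => rw [Function.iterate_succ_apply', Function.iterate_succ_apply', hcomm, ih]
  -- Surjectivity comes from compactness: the image of the closure of the orbit is the closure of
  -- its image.
  have himage : Ψ '' orbitClosure Φ R₀ = orbitClosure shift u := by
    rw [orbitClosure, image_closure_of_isCompact isClosed_closure.isCompact hΨ.continuousOn,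
      ← Set.range_comp]
    exact congrArg (fun f => closure (Set.range f)) (funext hiter)
  have hmaps : Set.MapsTo Ψ (orbitClosure Φ R₀) (orbitClosure shift u) :=
    himage ▸ Set.mapsTo_image _ _
  refine ⟨⟨orbitClosure Φ R₀, isClosed_closure, mapsTo_orbitClosure hΦ R₀⟩, rfl,
    hmaps.restrict, hΨ.continuousOn.mapsToRestrict hmaps, ?_, fun y => rfl⟩
  rintro ⟨x, hx⟩
  obtain ⟨R, hR, rfl⟩ := himage.symm ▸ (show x ∈ orbitClosure shift u from hx)
  exact ⟨⟨R, hR⟩, rfl⟩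

/-! ### Linear recurrences over Laurent polynomials as cellular automata -/

theorem LaurentPolynomial.coeff_mul_eq_sum {K : Type*} [CommRing K] (f g : LaurentPolynomial K)
    (m : ℤ) : (f * g).coeff m = f.coeff.sum fun k c => c * g.coeff (m - k) := by
  rw [AddMonoidAlgebra.coeff_mul_apply_left]
  simp [sub_eq_neg_add]

theorem PowerSeries.coeff_coe_mul_eq_sum_fin {R : Type*} [CommRing R] (P : R[X]) (S : PowerSeries R)
    {J : ℕ} (hJ : P.natDegree ≤ J) (n : ℕ) :
    PowerSeries.coeff n ((P : PowerSeries R) * S) = ∑ i : Fin (J + 1),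
      if (i : ℕ) ≤ n then P.coeff i * PowerSeries.coeff (n - i) S else 0 := by
  rw [PowerSeries.coeff_mul, Finset.Nat.sum_antidiagonal_eq_sum_range_succ_mk,
    Fin.sum_univ_eq_sum_range
      (fun i => if i ≤ n then P.coeff i * PowerSeries.coeff (n - i) S else 0) (J + 1),
    ← Finset.sum_filter]
  simp only [Polynomial.coeff_coe]
  symm
  apply Finset.sum_subset
  · intro i hi
    simp only [Finset.mem_filter, Finset.mem_range] at hi ⊢
    omega
  · intro i hi hi'
    simp only [Finset.mem_filter, Finset.mem_range] at hi hi'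
    rw [Polynomial.coeff_eq_zero_of_natDegree_lt (by omega), zero_mul]

section RecurrenceCA

variable {K : Type*} {J : ℕ}

/-- The automaton with memory `J + 1` whose newest row is `∑ i, q i * (row i steps ago)`. -/
noncomputable def recurrenceCA [CommRing K] (q : Fin (J + 1) → LaurentPolynomial K)
    (R : Config ℤ (Fin (J + 1) → K)) : Config ℤ (Fin (J + 1) → K) := fun m =>
  Fin.cons (∑ i, (q i).coeff.sum fun k c => c * R (m - k) i) fun j : Fin J => R m j.castSucc

/-- The configuration that is `1` in the first component of the cell `0` and `0` elsewhere. -/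
def impulse [CommRing K] : Config ℤ (Fin (J + 1) → K) := fun m j =>
  if m = 0 ∧ j = 0 then 1 else 0

theorem isEventuallyPeriodic_impulse [CommRing K] :
    IsEventuallyPeriodic (impulse : Config ℤ (Fin (J + 1) → K)) := by
  refine ⟨⟨1, 1, one_pos, fun m hm => ?_⟩, ⟨1, -1, one_pos, fun m hm => ?_⟩⟩ <;>
  · funext j
    simp only [impulse]
    rw [if_neg (by omega), if_neg (by omega)]

theorem isLinearCellularAutomaton_recurrenceCA [Field K]
    (q : Fin (J + 1) → LaurentPolynomial K) : IsLinearCellularAutomaton K (recurrenceCA q) where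
  continuous := by
    classical
    refine Config.continuous_iff.2 fun m => ?_
    let : TopologicalSpace (Fin (J + 1) → K) := ⊥
    refine continuous_of_finite_window _
      (insert m (Finset.univ.biUnion fun i => (q i).coeff.support.image fun k => m - k))
      fun R R' h => ?_
    simp only [Finset.mem_insert, Finset.mem_biUnion, Finset.mem_univ, true_and,
      Finset.mem_image] at h
    refine congrArg₂ Fin.cons ?_ ?_
    · refine Finset.sum_congr rfl fun i _ => Finset.sum_congr rfl fun k hk => ?_
      dsimp only
      rw [h (m - k) (Or.inr ⟨i, k, hk, rfl⟩)]
    · rw [h m (Or.inl rfl)]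
  comm_shift R := by
    funext m
    simp only [recurrenceCA, shift]
    simp only [sub_add_eq_add_sub]
  linear := by
    refine ⟨fun R R' => ?_, fun c R => ?_⟩ <;> funext m j <;> refine Fin.cases ?_ (fun j => ?_) j
    · change (∑ i, (q i).coeff.sum fun k c => c * (R (m - k) i + R' (m - k) i)) =
        (∑ i, (q i).coeff.sum fun k c => c * R (m - k) i) +
        ∑ i, (q i).coeff.sum fun k c => c * R' (m - k) i
      simp only [mul_add, Finsupp.sum_add, Finset.sum_add_distrib]
    · rfl
    · change (∑ i, (q i).coeff.sum fun k a => a * (c * R (m - k) i)) =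
        c * (∑ i, (q i).coeff.sum fun k a => a * R (m - k) i)
      simp only [Finsupp.sum, Finset.mul_sum]
      exact Finset.sum_congr rfl fun i _ => Finset.sum_congr rfl fun k _ => by ring
    · rfl

/-- Component `j` is a register for the coefficient of `S` from `j` steps ago, and the new row is
the recurrence given by `S = 1 + x * Q * S`. Coefficients of negative index count as zero, which is
why the impulse is the right start. -/
theorem recurrenceCA_iterate_impulse [CommRing K] (Q : (LaurentPolynomial K)[X])
    (hQ : Q.natDegree ≤ J) (S : PowerSeries (LaurentPolynomial K))
    (hS : S = 1 + PowerSeries.X * ((Q : PowerSeries (LaurentPolynomial K)) * S)) (n : ℕ) (m : ℤ) (j : Fin (J + 1)) :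
    (recurrenceCA (fun i : Fin (J + 1) => Q.coeff i))^[n] impulse m j =
      if (j : ℕ) ≤ n then (PowerSeries.coeff (n - j) S).coeff m else 0 := by
  induction n generalizing m j with
  | zero =>
    have h0 : PowerSeries.coeff 0 S = 1 := by rw [hS]; simp
    have h1 : ((1 : LaurentPolynomial K).coeff m) = if m = 0 then 1 else 0 := by
      rw [← LaurentPolynomial.T_zero, LaurentPolynomial.T_apply]; simp [eq_comm]
    simp only [Function.iterate_zero, id, impulse, nonpos_iff_eq_zero, Nat.zero_sub, h0, h1,
      Fin.val_eq_zero_iff]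
    clear hS
    split_ifs <;> simp_all
  | succ n ih =>
    rw [Function.iterate_succ_apply']
    refine Fin.cases ?_ (fun j => ?_) j
    · have h0 : PowerSeries.coeff (n + 1) S = PowerSeries.coeff n ((Q : PowerSeries (LaurentPolynomial K)) * S) := by
        conv_lhs => rw [hS]
        simp [PowerSeries.coeff_succ_X_mul, PowerSeries.coeff_one]
      simp only [Fin.val_zero, zero_le, if_true, Nat.sub_zero, h0, recurrenceCA, Fin.cons_zero]
      rw [PowerSeries.coeff_coe_mul_eq_sum_fin Q S hQ, AddMonoidAlgebra.coeff_sum,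
        Finsupp.finsetSum_apply]
      refine Finset.sum_congr rfl fun i _ => ?_
      simp only [ih]
      split_ifs with hi
      · rw [LaurentPolynomial.coeff_mul_eq_sum]
      · simp
    · simp only [recurrenceCA, Fin.cons_succ, ih, Fin.val_succ, Nat.add_sub_add_right,
        Fin.val_castSucc, add_le_add_iff_right]

/-- The coefficients of `y⁻¹` in finitely many rational functions `N a / (1 - x * Q)` are read off
one orbit of a linear cellular automaton. -/
theorem exists_linearCA_residue [Field K] {ι : Type*} [Finite ι] (Q : (LaurentPolynomial K)[X])
    (N : ι → (LaurentPolynomial K)[X]) (S : PowerSeries (LaurentPolynomial K))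
    (hS : S = 1 + PowerSeries.X * ((Q : PowerSeries (LaurentPolynomial K)) * S)) :
    ∃ (J : ℕ) (Φ : Config ℤ (Fin (J + 1) → K) → Config ℤ (Fin (J + 1) → K))
      (R₀ : Config ℤ (Fin (J + 1) → K)) (ℓ : ι → Config ℤ (Fin (J + 1) → K) → K) (s : Finset ℤ),
      IsLinearCellularAutomaton K Φ ∧ IsEventuallyPeriodic R₀ ∧
      (∀ a (R R' : Config ℤ (Fin (J + 1) → K)), (∀ m ∈ s, R m = R' m) → ℓ a R = ℓ a R') ∧
      ∀ a n, ℓ a (Φ^[n] R₀) = (PowerSeries.coeff n ((N a : PowerSeries (LaurentPolynomial K)) * S)).coeff (-1) := by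
  classical
  cases nonempty_fintype ι
  -- The stored rows must serve both the recurrence and the products with the numerators.
  obtain ⟨J, hJ, hN⟩ : ∃ J, Q.natDegree ≤ J ∧ ∀ a, (N a).natDegree ≤ J :=
    ⟨max Q.natDegree (Finset.univ.sup fun a => (N a).natDegree), le_max_left _ _, fun a =>
      (Finset.le_sup (f := fun a => (N a).natDegree) (Finset.mem_univ a)).trans (le_max_right _ _)⟩
  refine ⟨J, recurrenceCA fun i => Q.coeff i, impulse,
    fun a R => ∑ i : Fin (J + 1), ((N a).coeff i).coeff.sum fun k c => c * R (-1 - k) i,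
    Finset.univ.biUnion fun a => Finset.univ.biUnion fun i : Fin (J + 1) =>
      ((N a).coeff i).coeff.support.image fun k => -1 - k,
    isLinearCellularAutomaton_recurrenceCA _, isEventuallyPeriodic_impulse,
    fun a R R' h => ?_, fun a n => ?_⟩
  · simp only [Finset.mem_biUnion, Finset.mem_univ, true_and, Finset.mem_image] at h
    refine Finset.sum_congr rfl fun i _ => Finset.sum_congr rfl fun k hk => ?_
    dsimp only
    rw [h (-1 - k) ⟨a, i, k, hk, rfl⟩]
  · rw [PowerSeries.coeff_coe_mul_eq_sum_fin (N a) S (hN a), AddMonoidAlgebra.coeff_sum,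
      Finsupp.finsetSum_apply]
    refine Finset.sum_congr rfl fun i _ => ?_
    simp only [recurrenceCA_iterate_impulse Q hJ S hS]
    split_ifs with hi
    · rw [LaurentPolynomial.coeff_mul_eq_sum]
    · simp

end RecurrenceCA

/-! ### Residues in `y` of power series in `x` -/

section Residue

variable {K : Type*} [Field K]

/-- The coefficient of `y⁻¹` of a power series in `x` over the Laurent polynomials in `y`. -/
noncomputable def residue (W : PowerSeries (LaurentPolynomial K)) : PowerSeries K :=
  PowerSeries.mk fun n => (PowerSeries.coeff n W).coeff (-1)

theorem coeff_residue (n : ℕ) (W : PowerSeries (LaurentPolynomial K)) :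
    PowerSeries.coeff n (residue W) = (PowerSeries.coeff n W).coeff (-1) :=
  PowerSeries.coeff_mk _ _

theorem residue_add (V W : PowerSeries (LaurentPolynomial K)) :
    residue (V + W) = residue V + residue W := by
  ext n; simp [coeff_residue]

theorem residue_sub (V W : PowerSeries (LaurentPolynomial K)) :
    residue (V - W) = residue V - residue W := by
  ext n; simp [coeff_residue]

theorem residue_map_C_mul (r : PowerSeries K) (W : PowerSeries (LaurentPolynomial K)) :
    residue (PowerSeries.map LaurentPolynomial.C r * W) = r * residue W := by
  ext n
  rw [coeff_residue, PowerSeries.coeff_mul, PowerSeries.coeff_mul, AddMonoidAlgebra.coeff_sum,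
    Finsupp.finsetSum_apply]
  refine Finset.sum_congr rfl fun i _ => ?_
  rw [coeff_residue, PowerSeries.coeff_map, ← LaurentPolynomial.smul_eq_C_mul,
    AddMonoidAlgebra.coeff_smul_apply, smul_eq_mul]

theorem residue_C_T_neg_one :
    residue (PowerSeries.C (LaurentPolynomial.T (-1)) : PowerSeries (LaurentPolynomial K)) = 1 := by
  ext n
  rw [coeff_residue, PowerSeries.coeff_C, PowerSeries.coeff_one]
  split_ifs <;> simp

theorem Polynomial.coeff_neg_one_toLaurent (f : K[X]) : (toLaurent f).coeff (-1) = 0 := by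
  rw [LaurentPolynomial.coeff_toLaurent]
  refine Finsupp.mapDomain_of_notMem_range _ _ ?_
  rintro ⟨n, hn⟩
  simp only [Nat.castEmbedding_apply] at hn
  omega

theorem Polynomial.coeff_one_toLaurent (f : K[X]) : (toLaurent f).coeff 1 = f.coeff 1 := by
  rw [LaurentPolynomial.coeff_toLaurent]
  exact Finsupp.mapDomain_apply Nat.castEmbedding.injective _ 1

theorem residue_map_toLaurent (V : PowerSeries K[X]) :
    residue (PowerSeries.map toLaurent V) = 0 := by
  ext n
  rw [coeff_residue, PowerSeries.coeff_map, Polynomial.coeff_neg_one_toLaurent, map_zero]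

/-- The inclusion of the polynomials in `y⁻¹`. -/
noncomputable def toLaurentInv : K[X] →+* LaurentPolynomial K :=
  (LaurentPolynomial.invert (R := K) : LaurentPolynomial K →+* LaurentPolynomial K).comp toLaurent

theorem toLaurentInv_C (c : K) : toLaurentInv (C c) = LaurentPolynomial.C c := by
  simp [toLaurentInv]

theorem toLaurentInv_X : toLaurentInv (X : K[X]) = LaurentPolynomial.T (-1) := by
  simp [toLaurentInv]

theorem coeff_residue_map_toLaurentInv (V : PowerSeries K[X]) (n : ℕ) :
    PowerSeries.coeff n (residue (PowerSeries.map toLaurentInv V)) =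
      (PowerSeries.coeff n V).coeff 1 := by
  rw [coeff_residue, PowerSeries.coeff_map, ← Polynomial.coeff_one_toLaurent]
  simp only [toLaurentInv, RingHom.comp_apply]
  exact LaurentPolynomial.invert_apply _ _

theorem PowerSeries.map_map_apply {R S T : Type*} [Semiring R] [Semiring S] [Semiring T]
    (f : R →+* S) (g : S →+* T) (φ : PowerSeries R) :
    PowerSeries.map g (PowerSeries.map f φ) = PowerSeries.map (g.comp f) φ := by
  ext n; simp

theorem PowerSeries.constantCoeff_map_eq_zero {R S : Type*} [Semiring R] [Semiring S] (f : R →+* S)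
    {φ : PowerSeries R} (h : PowerSeries.constantCoeff φ = 0) :
    PowerSeries.constantCoeff (PowerSeries.map f φ) = 0 := by
  rw [← PowerSeries.coeff_zero_eq_constantCoeff_apply, PowerSeries.coeff_map,
    PowerSeries.coeff_zero_eq_constantCoeff_apply, h, map_zero]

/-- `1 / (y - g)` exists and the residue of `y / (y - g)` is `g`. -/
theorem exists_inv_sub_residue (g : PowerSeries K) (hg : PowerSeries.constantCoeff g = 0) :
    ∃ W : PowerSeries (LaurentPolynomial K),
      W * (PowerSeries.C (LaurentPolynomial.T 1) - PowerSeries.map LaurentPolynomial.C g) = 1 ∧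
      residue (PowerSeries.C (LaurentPolynomial.T 1) * W) = g := by
  -- Here `X` stands for `y⁻¹`: the inverse of `y - g` is `y⁻¹ / (1 - y⁻¹ * g)`, expanded in `y⁻¹`.
  have hunit : IsUnit (1 - PowerSeries.C (X : K[X]) * PowerSeries.map C g) := by
    rw [PowerSeries.isUnit_iff_constantCoeff, map_sub, map_mul, PowerSeries.constantCoeff_map_eq_zero _ hg]
    simp
  obtain ⟨V, hV⟩ := hunit.exists_left_inv
  set j := PowerSeries.map (toLaurentInv (K := K)) with hj
  have hjg : j (PowerSeries.map C g) = PowerSeries.map LaurentPolynomial.C g := by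
    rw [hj, PowerSeries.map_map_apply]
    congr 2
    ext1 c
    exact toLaurentInv_C c
  have hjX : j (PowerSeries.C X) = PowerSeries.C (LaurentPolynomial.T (-1)) := by
    rw [hj, PowerSeries.map_C, toLaurentInv_X]
  have hT : PowerSeries.C (LaurentPolynomial.T 1 : LaurentPolynomial K) *
      PowerSeries.C (LaurentPolynomial.T (-1)) = 1 := by
    rw [← map_mul, ← LaurentPolynomial.T_add]; simp
  refine ⟨j (PowerSeries.C X * V), ?_, ?_⟩
  · have := congrArg j hV
    rw [map_mul, map_sub, map_one, map_mul, hjX, hjg] at this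
    rw [map_mul, hjX]
    linear_combination this + (j V) * hT
  · rw [map_mul, hjX, ← mul_assoc, hT, one_mul]
    ext n
    rw [hj, coeff_residue_map_toLaurentInv]
    -- The geometric series up to its linear term; the rest is divisible by `y⁻²`, so the
    -- coefficient of `y⁻¹` is `g`.
    have hV' : V = 1 + PowerSeries.C X * PowerSeries.map C g +
        PowerSeries.C (X ^ 2) * ((PowerSeries.map C g) ^ 2 * V) := by
      rw [map_pow]
      linear_combination (1 + PowerSeries.C X * PowerSeries.map C g) * hV
    rw [hV', map_add, map_add, PowerSeries.coeff_C_mul, PowerSeries.coeff_C_mul,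
      PowerSeries.coeff_map, PowerSeries.coeff_one, coeff_add, coeff_add, coeff_X_mul,
      coeff_C_zero, coeff_X_pow_mul', if_neg (show ¬2 ≤ 1 by norm_num)]
    clear hV hV'
    split_ifs <;> simp [coeff_one]

/-- The residue of `y / F`, where `F = (y - g) (1 + (y - g) A)`. -/
theorem exists_inv_residue (g : PowerSeries K) (hg : PowerSeries.constantCoeff g = 0)
    (A : PowerSeries K[X]) (hA : PowerSeries.constantCoeff A = 0)
    (z : PowerSeries (LaurentPolynomial K))
    (hz : z = PowerSeries.C (LaurentPolynomial.T 1) - PowerSeries.map LaurentPolynomial.C g) :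
    ∃ W : PowerSeries (LaurentPolynomial K),
      W * (z * (1 + z * PowerSeries.map toLaurent A)) = 1 ∧
      residue (PowerSeries.C (LaurentPolynomial.T 1) * W) = g := by
  obtain ⟨W, hW, hres⟩ := exists_inv_sub_residue g hg
  rw [← hz] at hW
  set j := PowerSeries.map (toLaurent (R := K)) with hj
  have hjX : j (PowerSeries.C X) = PowerSeries.C (LaurentPolynomial.T 1) := by
    rw [hj, PowerSeries.map_C, toLaurent_X]
  have hjz : j (PowerSeries.C X - PowerSeries.map C g) = z := by
    rw [hz, map_sub, hjX, hj, PowerSeries.map_map_apply]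
    congr 3
    ext1 c
    exact toLaurent_C c
  have hunit : IsUnit (1 + (PowerSeries.C X - PowerSeries.map C g) * A) := by
    rw [PowerSeries.isUnit_iff_constantCoeff, map_add, map_mul, hA]
    simp
  obtain ⟨U, hU⟩ := hunit.exists_left_inv
  have hU' := congrArg j hU
  rw [map_mul, map_add, map_one, map_mul, hjz] at hU'
  refine ⟨W * j U, by linear_combination (j U * (1 + z * j A)) * hW + hU', ?_⟩
  -- From `U = 1 - z * A * U` and `z * W = 1`. The correction involves only nonnegative powers of
  -- `y`, so it has no residue.
  have : PowerSeries.C (LaurentPolynomial.T 1) * (W * j U) =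
      PowerSeries.C (LaurentPolynomial.T 1) * W - j (PowerSeries.C X * A * U) := by
    rw [map_mul, map_mul, hjX]
    linear_combination PowerSeries.C (LaurentPolynomial.T 1) * W * hU' -
      PowerSeries.C (LaurentPolynomial.T 1) * j A * j U * hW
  rw [this, residue_sub, hres, hj, residue_map_toLaurent, sub_zero]

end Residue

/-! ### From separable additive equations to cellular automata -/

section Realization

variable {K : Type*} [Field K]

/-- `f` is the residue of a rational function whose denominator has a unit as constant term. -/
def IsRationalResidue (f : PowerSeries K) : Prop :=
  ∃ (E N : (LaurentPolynomial K)[X]) (S : PowerSeries (LaurentPolynomial K)),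
    IsUnit (E.coeff 0) ∧ (E : PowerSeries (LaurentPolynomial K)) * S = 1 ∧
    residue ((N : PowerSeries (LaurentPolynomial K)) * S) = f

theorem PowerSeries.map_coe {R S : Type*} [CommSemiring R] [CommSemiring S] (φ : R →+* S)
    (P : R[X]) : PowerSeries.map φ (P : PowerSeries R) = (P.map φ : S[X]) := by
  ext n; simp

/-- Solutions of a separable additive equation `∑ a i * f ^ p ^ i = 0` are residues of rational
functions. -/
theorem isRationalResidue_of_additive_equation (p : ℕ) [Fact p.Prime] [CharP K p] (a : ℕ → K[X])
    (n : ℕ) (ha : a 0 ≠ 0) (f : PowerSeries K)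
    (hf : ∑ i ∈ Finset.range (n + 1), (a i : PowerSeries K) * f ^ p ^ i = 0) :
    IsRationalResidue f := by
  have hp : 2 ≤ p := (Fact.out : p.Prime).two_le
  have hpow (i : ℕ) : p ^ (i + 1) = p ^ (i + 1) - 2 + 2 := by
    have : p ≤ p ^ (i + 1) := Nat.le_self_pow (by omega) p
    omega
  -- factor the linear coefficient and split off a truncation of the solution
  obtain ⟨v, b, hab, hb⟩ : ∃ (v : ℕ) (b : K[X]), a 0 = X ^ v * b ∧ b.coeff 0 ≠ 0 := by
    obtain ⟨b, hb, hX⟩ := exists_eq_pow_rootMultiplicity_mul_and_not_dvd (a 0) ha 0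
    rw [C_0, sub_zero] at hb hX
    exact ⟨_, b, hb, fun h => hX (X_dvd_iff.2 h)⟩
  obtain ⟨b', hb'⟩ : ∃ b' : PowerSeries K, (b : PowerSeries K) * b' = 1 := by
    refine IsUnit.exists_right_inv (PowerSeries.isUnit_iff_constantCoeff.2 ?_)
    simpa [Polynomial.constantCoeff_coe] using hb
  obtain ⟨s, g, hg, hfs⟩ : ∃ (s : K[X]) (g : PowerSeries K), PowerSeries.constantCoeff g = 0 ∧
      f = (s : PowerSeries K) + (a 0 : PowerSeries K) * PowerSeries.X * g := by
    -- `a 0 * X` has order `v + 1`; truncating one order later leaves `g` without constant term.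
    obtain ⟨h, hh⟩ : PowerSeries.X ^ (v + 2) ∣ f - ((PowerSeries.trunc (v + 2) f : K[X]) : PowerSeries K) := by
      refine PowerSeries.X_pow_dvd_iff.2 fun m hm => ?_
      rw [map_sub, Polynomial.coeff_coe, PowerSeries.coeff_trunc, if_pos hm, sub_self]
    refine ⟨PowerSeries.trunc (v + 2) f, PowerSeries.X * h * b', by simp, ?_⟩
    rw [hab, Polynomial.coe_mul, Polynomial.coe_pow, Polynomial.coe_X]
    linear_combination hh - PowerSeries.X ^ (v + 2) * h * hb'
  -- the equation satisfied by the tail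
  let β : ℕ → K[X] := fun i => a (i + 1) * (a 0 * X) ^ (p ^ (i + 1) - 2) * X
  -- Substitute `f = s + a 0 * X * g` and take out `a 0 ^ 2 * X = X ^ (2 * v + 1) * b ^ 2`. Then `g`
  -- gets coefficient 1, and every `β i` keeps a factor `X`.
  have hCeq : ((∑ i ∈ Finset.range (n + 1), a i * s ^ p ^ i : K[X]) : PowerSeries K) =
      PowerSeries.X ^ (2 * v + 1) * (-(b : PowerSeries K) ^ 2 *
        (g + ∑ i ∈ Finset.range n, (β i : PowerSeries K) * g ^ p ^ (i + 1))) := by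
    have h1 : ∀ i, (a i : PowerSeries K) * f ^ p ^ i = ((a i * s ^ p ^ i : K[X]) : PowerSeries K) +
        (a i : PowerSeries K) * ((a 0 : PowerSeries K) * PowerSeries.X * g) ^ p ^ i := by
      intro i
      have : CharP (PowerSeries K) p := charP_of_injective_ringHom
        (PowerSeries.C_injective (R := K)) p
      rw [hfs, add_pow_char_pow, Polynomial.coe_mul, Polynomial.coe_pow]
      ring
    simp only [h1, Finset.sum_add_distrib] at hf
    rw [Finset.sum_range_succ' (fun i => (a i : PowerSeries K) *
      ((a 0 : PowerSeries K) * PowerSeries.X * g) ^ p ^ i)] at hf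
    have h4 : (a 0 : PowerSeries K) = (PowerSeries.X : PowerSeries K) ^ v * b := by
      rw [hab, Polynomial.coe_mul, Polynomial.coe_pow, Polynomial.coe_X]
    have h2 : ∀ i ∈ Finset.range n, (a (i + 1) : PowerSeries K) *
        ((a 0 : PowerSeries K) * PowerSeries.X * g) ^ p ^ (i + 1) =
        PowerSeries.X ^ (2 * v + 1) * ((b : PowerSeries K) ^ 2 *
          ((β i : PowerSeries K) * g ^ p ^ (i + 1))) := by
      intro i _
      have h3 : ((a 0 : PowerSeries K) * PowerSeries.X) ^ p ^ (i + 1) =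
          ((a 0 : PowerSeries K) * PowerSeries.X) ^ (p ^ (i + 1) - 2) *
          ((a 0 : PowerSeries K) * PowerSeries.X) ^ 2 := by
        rw [← pow_add, ← hpow]
      rw [mul_pow, h3]
      simp only [β, Polynomial.coe_mul, Polynomial.coe_pow, Polynomial.coe_X]
      generalize ((a 0 : PowerSeries K) * PowerSeries.X) ^ (p ^ (i + 1) - 2) = t
      rw [h4]
      ring
    rw [Finset.sum_congr rfl h2, ← Finset.mul_sum, ← Finset.mul_sum] at hf
    rw [h4, pow_zero, pow_one] at hf
    rw [← Polynomial.coeToPowerSeries.ringHom_apply (R := K), map_sum]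
    simp only [Polynomial.coeToPowerSeries.ringHom_apply]
    linear_combination hf
  obtain ⟨c, hc⟩ : X ^ (2 * v + 1) ∣ ∑ i ∈ Finset.range (n + 1), a i * s ^ p ^ i := by
    refine Polynomial.X_pow_dvd_iff.2 fun m hm => ?_
    rw [← Polynomial.coeff_coe, hCeq, PowerSeries.coeff_X_pow_mul', if_neg (by omega)]
  have hceq : (c : PowerSeries K) = -(b : PowerSeries K) ^ 2 *
      (g + ∑ i ∈ Finset.range n, (β i : PowerSeries K) * g ^ p ^ (i + 1)) := by
    rw [hc, Polynomial.coe_mul, Polynomial.coe_pow, Polynomial.coe_X] at hCeq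
    exact mul_left_cancel₀ (pow_ne_zero _ PowerSeries.X_ne_zero) hCeq
  have hc0 : c.coeff 0 = 0 := by
    rw [← Polynomial.coeff_coe, PowerSeries.coeff_zero_eq_constantCoeff_apply, hceq]
    simp only [map_mul, map_add, map_sum, map_pow, hg]
    simp [(Nat.pos_of_neZero p).ne']
  -- the denominator
  let ψ : PowerSeries K →+* PowerSeries (LaurentPolynomial K) :=
    PowerSeries.map LaurentPolynomial.C
  have hψ (P : K[X]) : ψ P = (P.map LaurentPolynomial.C : (LaurentPolynomial K)[X]) :=
    PowerSeries.map_coe _ P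
  let y : LaurentPolynomial K := LaurentPolynomial.T 1
  let E : (LaurentPolynomial K)[X] := (b ^ 2).map LaurentPolynomial.C *
    (C y + ∑ i ∈ Finset.range n, (β i).map LaurentPolynomial.C * C y ^ p ^ (i + 1)) +
    c.map LaurentPolynomial.C
  let A : PowerSeries K[X] := ∑ i ∈ Finset.range n, PowerSeries.map C (β i : PowerSeries K) *
    (PowerSeries.C X - PowerSeries.map C g) ^ (p ^ (i + 1) - 2)
  have hA : PowerSeries.constantCoeff A = 0 := by
    rw [map_sum]
    refine Finset.sum_eq_zero fun i _ => ?_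
    rw [map_mul, PowerSeries.constantCoeff_map_eq_zero, zero_mul]
    simp [β, Polynomial.constantCoeff_coe]
  obtain ⟨W, hW, hres⟩ := exists_inv_residue g hg A hA _ rfl
  have hjA : PowerSeries.map toLaurent A = ∑ i ∈ Finset.range n, ψ (β i : PowerSeries K) *
      (PowerSeries.C y - ψ g) ^ (p ^ (i + 1) - 2) := by
    have hcomp (r : PowerSeries K) :
        PowerSeries.map (toLaurent (R := K)) (PowerSeries.map C r) = ψ r := by
      rw [PowerSeries.map_map_apply]
      congr 2
      ext1 c
      exact toLaurent_C c
    simp only [A, map_sum, map_mul, map_pow, map_sub, hcomp, PowerSeries.map_C, toLaurent_X]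
    rfl
  -- As a polynomial in `y`, `E` vanishes at `g` by `hceq`. Its nonconstant part is additive, so `E`
  -- is that part evaluated at `y - g`.
  have hE : (E : PowerSeries (LaurentPolynomial K)) = ψ (b : PowerSeries K) ^ 2 *
      ((PowerSeries.C y - ψ g) * (1 + (PowerSeries.C y - ψ g) * PowerSeries.map toLaurent A)) := by
    have hchar : CharP (PowerSeries (LaurentPolynomial K)) p := charP_of_injective_ringHom
      (f := (PowerSeries.C (R := LaurentPolynomial K)).comp LaurentPolynomial.C)
      (RingHom.injective _) p
    have h1 (i : ℕ) : (PowerSeries.C y - ψ g) * ((PowerSeries.C y - ψ g) * (ψ (β i : PowerSeries K) *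
        (PowerSeries.C y - ψ g) ^ (p ^ (i + 1) - 2))) =
        ψ (β i : PowerSeries K) * (PowerSeries.C y ^ p ^ (i + 1) - ψ g ^ p ^ (i + 1)) := by
      rw [← sub_pow_char_pow, hpow i]
      simp only [Nat.add_sub_cancel]
      ring
    have h2 : (E : PowerSeries (LaurentPolynomial K)) = ψ (b : PowerSeries K) ^ 2 *
        (PowerSeries.C y + ∑ i ∈ Finset.range n,
          ψ (β i : PowerSeries K) * PowerSeries.C y ^ p ^ (i + 1)) + ψ (c : PowerSeries K) := by
      simp only [E, ← Polynomial.coeToPowerSeries.ringHom_apply, map_add, map_mul, map_sum,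
        map_pow, Polynomial.map_pow]
      simp only [Polynomial.coeToPowerSeries.ringHom_apply, ← hψ, Polynomial.coe_C]
    rw [h2, hceq, hjA, mul_add (PowerSeries.C y - ψ g), mul_one, Finset.mul_sum, Finset.mul_sum,
      Finset.sum_congr rfl fun i _ => h1 i]
    simp only [map_mul, map_neg, map_pow, map_add, map_sum, mul_sub, Finset.sum_sub_distrib]
    ring
  have hE0 : E.coeff 0 = LaurentPolynomial.C (b.coeff 0 ^ 2) * y := by
    simp only [E, coeff_add, mul_coeff_zero, coeff_map, finsetSum_coeff, hc0, coeff_C_zero]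
    simp [β, pow_two]
  have hbb : ψ (b : PowerSeries K) * ψ b' = 1 := by rw [← map_mul, hb', map_one]
  have hES : (E : PowerSeries (LaurentPolynomial K)) * (W * ψ b' ^ 2) = 1 := by
    rw [hE]
    linear_combination (ψ b * ψ b') ^ 2 * hW + (ψ b * ψ b' + 1) * hbb
  -- The first summand of the numerator contributes `s * y⁻¹`, with residue `s`; the second
  -- contributes `a 0 * X` times `y * W`, with residue `a 0 * X * g`.
  refine ⟨E, C (LaurentPolynomial.T (-1)) * s.map LaurentPolynomial.C * E +
    (a 0 * X * b ^ 2).map LaurentPolynomial.C * C y, W * ψ b' ^ 2, ?_, hES, ?_⟩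
  · rw [hE0]
    exact ((IsUnit.mk0 _ (pow_ne_zero 2 hb)).map LaurentPolynomial.C).mul
      (LaurentPolynomial.isUnit_T 1)
  · have : ((C (LaurentPolynomial.T (-1)) * s.map LaurentPolynomial.C * E +
        (a 0 * X * b ^ 2).map LaurentPolynomial.C * C y : (LaurentPolynomial K)[X]) :
          PowerSeries (LaurentPolynomial K)) * (W * ψ b' ^ 2) =
        ψ s * PowerSeries.C (LaurentPolynomial.T (-1)) +
        ψ ((a 0 : PowerSeries K) * PowerSeries.X) * (PowerSeries.C y * W) := by
      simp only [Polynomial.coe_add, Polynomial.coe_mul, Polynomial.coe_C, ← hψ, map_mul,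
        Polynomial.coe_pow, map_pow, Polynomial.coe_X]
      linear_combination PowerSeries.C (LaurentPolynomial.T (-1)) * ψ s * hES +
        ψ (a 0) * ψ PowerSeries.X * PowerSeries.C y * W * (ψ b * ψ b' + 1) * hbb
    rw [this, residue_add, residue_map_C_mul, residue_map_C_mul, residue_C_T_neg_one, hres, hfs,
      mul_one]

/-- Finitely many residues of rational functions are read off one orbit of a linear cellular
automaton. -/
theorem exists_linearCA_of_isRationalResidue {ι : Type*} [Finite ι] (f : ι → PowerSeries K)
    (hf : ∀ a, IsRationalResidue (f a)) :
    ∃ (J : ℕ) (Φ : Config ℤ (Fin (J + 1) → K) → Config ℤ (Fin (J + 1) → K))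
      (R₀ : Config ℤ (Fin (J + 1) → K)) (ℓ : ι → Config ℤ (Fin (J + 1) → K) → K) (s : Finset ℤ),
      IsLinearCellularAutomaton K Φ ∧ IsEventuallyPeriodic R₀ ∧
      (∀ a (R R' : Config ℤ (Fin (J + 1) → K)), (∀ m ∈ s, R m = R' m) → ℓ a R = ℓ a R') ∧
      ∀ a n, ℓ a (Φ^[n] R₀) = PowerSeries.coeff n (f a) := by
  classical
  cases nonempty_fintype ι
  choose E N S hE hES hres using hf
  have hunit : IsUnit ((∏ a, E a).coeff 0) := by
    rw [Polynomial.coeff_zero_prod]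
    exact IsUnit.prod_univ_iff.2 hE
  obtain ⟨e, he⟩ := hunit.exists_left_inv
  -- The common denominator, divided by its constant term, has the form `1 - X * Q`; its inverse is
  -- the product of the `S a` times that constant term.
  let Q : (LaurentPolynomial K)[X] := -(C e * ∏ a, E a).divX
  have hQ : C e * ∏ a, E a = 1 - X * Q := by
    conv_lhs => rw [← divX_mul_X_add (C e * ∏ a, E a)]
    rw [mul_coeff_zero, coeff_C_zero, he, map_one]
    simp only [Q]
    ring
  let S' : PowerSeries (LaurentPolynomial K) := ∏ a, S a
  have hprod : ((∏ a, E a : (LaurentPolynomial K)[X]) : PowerSeries (LaurentPolynomial K)) * S' =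
      1 := by
    rw [← Polynomial.coeToPowerSeries.ringHom_apply, map_prod, ← Finset.prod_mul_distrib]
    exact Finset.prod_eq_one fun a _ => hES a
  have hQ' : PowerSeries.C e * ((∏ a, E a : (LaurentPolynomial K)[X]) :
      PowerSeries (LaurentPolynomial K)) = 1 - PowerSeries.X * (Q : PowerSeries _) := by
    have := congrArg (fun P : (LaurentPolynomial K)[X] => (P : PowerSeries (LaurentPolynomial K))) hQ
    simpa only [Polynomial.coe_mul, Polynomial.coe_C, Polynomial.coe_sub, Polynomial.coe_one,
      Polynomial.coe_X] using this
  have he' : PowerSeries.C e * PowerSeries.C ((∏ a, E a).coeff 0) = 1 := by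
    rw [← map_mul, he, map_one]
  obtain ⟨J, Φ, R₀, ℓ, s, hΦ, hR₀, hs, hℓ⟩ := exists_linearCA_residue Q
    (fun a => C e * N a * ∏ b ∈ Finset.univ.erase a, E b)
    (PowerSeries.C ((∏ a, E a).coeff 0) * S') (by
      linear_combination -(PowerSeries.C ((∏ a, E a).coeff 0) * S') * hQ' + hprod +
        ((∏ a, E a : (LaurentPolynomial K)[X]) : PowerSeries (LaurentPolynomial K)) * S' * he')
  refine ⟨J, Φ, R₀, ℓ, s, hΦ, hR₀, hs, fun a n => ?_⟩
  have hother : ((∏ b ∈ Finset.univ.erase a, E b : (LaurentPolynomial K)[X]) :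
      PowerSeries (LaurentPolynomial K)) * ∏ b ∈ Finset.univ.erase a, S b = 1 := by
    rw [← Polynomial.coeToPowerSeries.ringHom_apply, map_prod, ← Finset.prod_mul_distrib]
    exact Finset.prod_eq_one fun a _ => hES a
  have hS' : S' = S a * ∏ b ∈ Finset.univ.erase a, S b :=
    (Finset.mul_prod_erase _ _ (Finset.mem_univ a)).symm
  rw [hℓ, ← coeff_residue, ← hres a, Polynomial.coe_mul, Polynomial.coe_mul, Polynomial.coe_C]
  congr 2
  rw [hS']
  linear_combination (N a : PowerSeries (LaurentPolynomial K)) * S a * hother +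
    (N a : PowerSeries (LaurentPolynomial K)) * S a *
      ((∏ b ∈ Finset.univ.erase a, E b : (LaurentPolynomial K)[X]) :
        PowerSeries (LaurentPolynomial K)) * (∏ b ∈ Finset.univ.erase a, S b) * he'

end Realization

/-! ### Additive equations by Christol's argument -/

section Christol

variable {K : Type*} [Field K]

/-- The Cartier operator: the power series of the coefficients in the residue class `r` modulo
`p`. -/
noncomputable def cartier (p r : ℕ) (f : PowerSeries K) : PowerSeries K :=
  PowerSeries.mk fun n => PowerSeries.coeff (p * n + r) f

theorem cartier_sum (p r : ℕ) {ι : Type*} (s : Finset ι) (f : ι → PowerSeries K) :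
    cartier p r (∑ i ∈ s, f i) = ∑ i ∈ s, cartier p r (f i) := by
  ext n
  simp [cartier]

/-- Over the prime field, raising a power series to the power `p` substitutes `x ^ p`. -/
theorem pow_char_eq_expand (p : ℕ) [hp : Fact p.Prime] [CharP K p]
    (hK : ∀ c : K, c ^ p = c) (f : PowerSeries K) :
    f ^ p = PowerSeries.expand p hp.out.ne_zero f := by
  have hchar : CharP (PowerSeries K) p := charP_of_injective_ringHom
    (PowerSeries.C_injective (R := K)) p
  ext n
  -- The `p`-th power of a remainder divisible by `x ^ (n + 1)` does not affect coefficient `n`, so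
  -- the polynomial case suffices.
  have h1 : ∃ g,
      f = ((PowerSeries.trunc (n + 1) f : K[X]) : PowerSeries K) + PowerSeries.X ^ (n + 1) * g := by
    obtain ⟨g, hg⟩ : PowerSeries.X ^ (n + 1) ∣
        f - ((PowerSeries.trunc (n + 1) f : K[X]) : PowerSeries K) := by
      refine PowerSeries.X_pow_dvd_iff.2 fun m hm => ?_
      rw [map_sub, Polynomial.coeff_coe, PowerSeries.coeff_trunc, if_pos hm, sub_self]
    exact ⟨g, by rw [← hg]; ring⟩
  have hpoly (P : K[X]) : P ^ p = Polynomial.expand K p P := by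
    have h := Polynomial.map_frobenius_expand (R := K) (p := p) (f := P)
    rw [← h]
    have : frobenius K p = RingHom.id K := RingHom.ext hK
    rw [this, Polynomial.map_id]
  obtain ⟨g, hg⟩ := h1
  have hpos : 0 < p := hp.out.pos
  have hle : n + 1 ≤ (n + 1) * p := Nat.le_mul_of_pos_right _ hpos
  conv_lhs => rw [hg, add_pow_char, mul_pow, ← Polynomial.coe_pow, hpoly, ← pow_mul, map_add,
    PowerSeries.coeff_X_pow_mul', if_neg (by omega), add_zero, Polynomial.coeff_coe,
    Polynomial.coeff_expand hpos]
  rw [PowerSeries.coeff_expand]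
  split_ifs with h
  · rw [PowerSeries.coeff_trunc, if_pos (Nat.lt_succ_of_le (Nat.div_le_self _ _))]
  · rfl

/-- Since `f ^ p` only has exponents divisible by `p`, the class of an exponent modulo `p` is
decided by the factor `a`. -/
theorem cartier_mul_pow (p r : ℕ) [hp : Fact p.Prime] [CharP K p] (hK : ∀ c : K, c ^ p = c)
    (hr : r < p) (a f : PowerSeries K) :
    cartier p r (a * f ^ p) = cartier p r a * f := by
  ext n
  have hpos : 0 < p := hp.out.pos
  rw [cartier, PowerSeries.coeff_mk, pow_char_eq_expand p hK, mul_comm a,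
    mul_comm (cartier p r a), PowerSeries.coeff_mul, PowerSeries.coeff_mul,
    Finset.Nat.sum_antidiagonal_eq_sum_range_succ_mk,
    Finset.Nat.sum_antidiagonal_eq_sum_range_succ_mk]
  symm
  refine Finset.sum_of_injOn (fun i => p * i) ?_ ?_ ?_ ?_
  · exact fun i _ j _ h => Nat.eq_of_mul_eq_mul_left hpos h
  · intro i hi
    simp only [Finset.coe_range, Set.mem_Iio] at hi ⊢
    nlinarith
  · intro i hi hi'
    dsimp only
    rw [PowerSeries.coeff_expand_of_not_dvd, zero_mul]
    rintro ⟨j, rfl⟩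
    refine hi' ⟨j, ?_, rfl⟩
    simp only [Finset.coe_range, Set.mem_Iio, Finset.mem_range] at hi ⊢
    by_contra hj
    nlinarith
  · intro i hi
    dsimp only
    rw [PowerSeries.coeff_expand_mul, cartier, PowerSeries.coeff_mk]
    simp only [Finset.mem_range] at hi
    congr 3
    rw [Nat.mul_sub]
    have : p * i ≤ p * n := Nat.mul_le_mul_left _ (by omega)
    omega

theorem exists_polynomial_cartier (p r : ℕ) [hp : Fact p.Prime] (a : K[X]) :
    ∃ b : K[X], (b : PowerSeries K) = cartier p r a := by
  refine ⟨PowerSeries.trunc (a.natDegree + 1) (cartier p r a), ?_⟩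
  ext n
  rw [Polynomial.coeff_coe, PowerSeries.coeff_trunc]
  split_ifs with h
  · rfl
  · have := Nat.le_mul_of_pos_left n hp.out.pos
    rw [cartier, PowerSeries.coeff_mk, Polynomial.coeff_coe,
      coeff_eq_zero_of_natDegree_lt (by omega)]

theorem exists_cartier_ne_zero (p : ℕ) [hp : Fact p.Prime] {a : PowerSeries K} (ha : a ≠ 0) :
    ∃ r < p, cartier p r a ≠ 0 := by
  by_contra! h
  refine ha (PowerSeries.ext fun n => ?_)
  have := congrArg (PowerSeries.coeff (n / p)) (h (n % p) (Nat.mod_lt _ hp.out.pos))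
  rwa [cartier, PowerSeries.coeff_mk, Nat.div_add_mod] at this

/-- A nontrivial additive equation can be replaced by a separable one. -/
theorem exists_separable_additive_equation (p : ℕ) [hp : Fact p.Prime] [CharP K p]
    (hK : ∀ c : K, c ^ p = c) (f : PowerSeries K) (n : ℕ) (a : ℕ → K[X])
    (ha : ∃ i < n, a i ≠ 0)
    (hf : ∑ i ∈ Finset.range n, (a i : PowerSeries K) * f ^ p ^ i = 0) :
    ∃ (n : ℕ) (a : ℕ → K[X]), a 0 ≠ 0 ∧
      ∑ i ∈ Finset.range (n + 1), (a i : PowerSeries K) * f ^ p ^ i = 0 := by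
  induction n generalizing a with
  | zero => obtain ⟨i, hi, -⟩ := ha; omega
  | succ n ih =>
    by_cases h0 : a 0 = 0
    · obtain ⟨i, hi, hai⟩ := ha
      obtain ⟨i, rfl⟩ := Nat.exists_eq_succ_of_ne_zero (show i ≠ 0 by rintro rfl; exact hai h0)
      -- With `a 0 = 0`, a Cartier operator lowers each `p ^ (i + 1)` to `p ^ i`; `r` is chosen so
      -- that a nonzero coefficient survives.
      obtain ⟨r, hr, hne⟩ := exists_cartier_ne_zero p
        (show (a (i + 1) : PowerSeries K) ≠ 0 by simpa using hai)
      choose b hb using fun i => exists_polynomial_cartier p r (a (i + 1))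
      refine ih b ⟨i, by omega, ?_⟩ ?_
      · rintro h
        rw [← hb, h, Polynomial.coe_zero] at hne
        exact hne rfl
      · rw [Finset.sum_range_succ', h0, Polynomial.coe_zero, zero_mul, add_zero] at hf
        have := congrArg (cartier p r) hf
        rw [cartier_sum] at this
        simp only [pow_succ p, pow_mul, cartier_mul_pow p r hK hr, ← hb] at this
        rw [this]
        ext n
        simp [cartier]
    · exact ⟨n, a, h0, hf⟩

/-- The components of a solution of `f = M f ^ p` satisfy nontrivial additive equations. -/
theorem exists_additive_equation (p : ℕ) [hp : Fact p.Prime] [CharP K p] {ι : Type*} [Fintype ι]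
    (f : ι → PowerSeries K) (M : ι → ι → K[X])
    (hf : ∀ t, f t = ∑ s, (M t s : PowerSeries K) * f s ^ p) (t : ι) :
    ∃ (n : ℕ) (a : ℕ → K[X]), (∃ i < n, a i ≠ 0) ∧
      ∑ i ∈ Finset.range n, (a i : PowerSeries K) * f t ^ p ^ i = 0 := by
  have hchar : CharP (PowerSeries K) p := charP_of_injective_ringHom
    (PowerSeries.C_injective (R := K)) p
  have hiter (k : ℕ) : ∃ B : ι → K[X], f t = ∑ s, (B s : PowerSeries K) * f s ^ p ^ k := by
    classical
    induction k with
    | zero => exact ⟨Pi.single t 1, by simp [Pi.single_apply, Finset.sum_ite_eq', ite_mul, apply_ite]⟩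
    | succ k ih =>
      obtain ⟨B, hB⟩ := ih
      refine ⟨fun r => ∑ s, B s * M s r ^ p ^ k, ?_⟩
      have h1 (s : ι) : f s ^ p ^ k =
          ∑ r, (M s r : PowerSeries K) ^ p ^ k * f r ^ p ^ (k + 1) := by
        conv_lhs => rw [hf s, sum_pow_char_pow]
        exact Finset.sum_congr rfl fun r _ => by rw [mul_pow, ← pow_mul, pow_succ']
      rw [hB]
      simp only [h1, Finset.mul_sum, ← Polynomial.coeToPowerSeries.ringHom_apply, map_sum, map_mul,
        map_pow, Finset.sum_mul]
      rw [Finset.sum_comm]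
      exact Finset.sum_congr rfl fun r _ => Finset.sum_congr rfl fun s _ => by ring
  let n := Fintype.card ι
  -- These `n + 1` powers are all combinations of the same `n` series `f s ^ p ^ n`, so their
  -- coefficient vectors in `K[X] ^ n` are dependent.
  have hspan (i : Fin (n + 1)) : ∃ B : ι → K[X],
      f t ^ p ^ (i : ℕ) = ∑ s, (B s : PowerSeries K) * f s ^ p ^ n := by
    obtain ⟨B, hB⟩ := hiter (n - i)
    refine ⟨fun s => B s ^ p ^ (i : ℕ), ?_⟩
    rw [hB, sum_pow_char_pow]
    refine Finset.sum_congr rfl fun r _ => ?_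
    rw [mul_pow, ← pow_mul, ← pow_add, Polynomial.coe_pow, Nat.sub_add_cancel (by omega)]
  choose B hB using hspan
  have hdep : ¬LinearIndependent K[X] B := fun h => by
    have := h.fintype_card_le_finrank
    simp [n] at this
  obtain ⟨c, hc, i, hi⟩ := Fintype.not_linearIndependent_iff.1 hdep
  refine ⟨n + 1, fun i => if h : i < n + 1 then c ⟨i, h⟩ else 0, ⟨i, i.2, by dsimp only; rwa [dif_pos i.2]⟩, ?_⟩
  rw [Finset.sum_range]
  simp only [Fin.is_lt, dif_pos, hB, Finset.mul_sum, Fin.eta]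
  rw [Finset.sum_comm]
  refine Finset.sum_eq_zero fun s _ => ?_
  have := congrArg (fun P : K[X] => (P : PowerSeries K)) (congrFun hc s)
  simp only [Finset.sum_apply, Pi.smul_apply, smul_eq_mul, Pi.zero_apply,
    ← Polynomial.coeToPowerSeries.ringHom_apply, map_sum, map_mul, map_zero] at this
  simp only [← mul_assoc, ← Finset.sum_mul]
  simp only [Polynomial.coeToPowerSeries.ringHom_apply] at this
  rw [this, zero_mul]

end Christol

/-! ### Automatic sequences and the conclusion -/

theorem digitWord_mul_add (p : ℕ) [NeZero p] (hp : 1 < p) (n r : ℕ) (hr : r < p)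
    (h : r ≠ 0 ∨ n ≠ 0) : digitWord p (p * n + r) = Fin.ofNat p r :: digitWord p n := by
  rw [digitWord, add_comm, Nat.digits_add p hp r n hr h, List.map_cons, digitWord]

/-- An automatic sequence is a component of a finite system of sequences that is closed under
taking arithmetic subsequences of difference `p`. -/
theorem IsAutomatic.exists_kernel.{v} {p : ℕ} [NeZero p] (hp : 1 < p) {A : Type v} [Finite A]
    {u : ℕ → A}
    (hu : IsAutomatic p u) :
    ∃ (T : Type v) (_ : Finite T) (w : T → ℕ → A) (δ : T → ℕ → T) (t₀ : T),
      w t₀ = u ∧ ∀ t n, ∀ r < p, w t (p * n + r) = w (δ t r) n := by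
  classical
  obtain ⟨S, hS, M, hM⟩ := hu
  -- The output may change when a zero is appended to the word. The second component therefore
  -- carries the value at index 0: the digit 0 preserves it, a nonzero digit resets it.
  refine ⟨S × A, inferInstance,
    fun t n => if n = 0 then t.2 else M.output ((digitWord p n).foldl M.step t.1),
    fun t r => (M.step t.1 (Fin.ofNat p r),
      if r = 0 then t.2 else M.output (M.step t.1 (Fin.ofNat p r))), (M.start, u 0), ?_, ?_⟩
  · funext n
    dsimp only
    split_ifs with hn
    · rw [hn]
    · rw [hM]; rfl
  · intro t n r hr
    by_cases h : r ≠ 0 ∨ n ≠ 0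
    · dsimp only
      have : p * n + r ≠ 0 := by
        rcases h with h | h
        · omega
        · have := Nat.mul_pos (show 0 < p by omega) (Nat.pos_of_ne_zero h)
          omega
      rw [if_neg this, digitWord_mul_add p hp n r hr h, List.foldl_cons]
      split_ifs with hn hr0
      · omega
      · subst hn; simp [digitWord]
      · rfl
    · push Not at h
      obtain ⟨rfl, rfl⟩ := h
      simp

/-- The indicator series of the letters of an automatic sequence are residues of rational
functions. -/
theorem IsAutomatic.isRationalResidue {p : ℕ} [hp : Fact p.Prime] {K : Type*} [Field K] [CharP K p]
    (hK : ∀ c : K, c ^ p = c) {A : Type*} [Finite A] [DecidableEq A] {u : ℕ → A}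
    (hu : IsAutomatic p u) (c : A) :
    IsRationalResidue (PowerSeries.mk fun n => if u n = c then (1 : K) else 0) := by
  classical
  obtain ⟨T, hT, w, δ, t₀, rfl, hw⟩ := hu.exists_kernel hp.out.one_lt
  cases nonempty_fintype T
  let f : T → PowerSeries K := fun t => PowerSeries.mk fun n => if w t n = c then (1 : K) else 0
  let M : T → T → K[X] := fun t s => ∑ r ∈ Finset.range p, if δ t r = s then X ^ r else 0
  -- Split exponents by their class modulo `p` and use `f(x ^ p) = f ^ p`.
  have hf (t : T) : f t = ∑ s, (M t s : PowerSeries K) * f s ^ p := by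
    have h1 : ∑ s, (M t s : PowerSeries K) * f s ^ p =
        ∑ r ∈ Finset.range p, PowerSeries.X ^ r * f (δ t r) ^ p := by
      have h2 (s : T) : (M t s : PowerSeries K) * f s ^ p =
          ∑ r ∈ Finset.range p, if δ t r = s then PowerSeries.X ^ r * f s ^ p else 0 := by
        rw [← Polynomial.coeToPowerSeries.ringHom_apply, map_sum, Finset.sum_mul]
        refine Finset.sum_congr rfl fun r _ => ?_
        split_ifs <;> simp
      simp only [h2]
      rw [Finset.sum_comm]
      simp
    ext m
    have hpos := hp.out.pos
    rw [h1, map_sum, Finset.sum_eq_single (m % p)]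
    · rw [PowerSeries.coeff_X_pow_mul', if_pos (Nat.mod_le _ _), pow_char_eq_expand p hK,
        show m - m % p = p * (m / p) by have := Nat.mod_add_div m p; omega,
        PowerSeries.coeff_expand_mul, PowerSeries.coeff_mk, PowerSeries.coeff_mk,
        ← hw t _ _ (Nat.mod_lt m hpos), Nat.div_add_mod]
    · intro r hr hne
      rw [PowerSeries.coeff_X_pow_mul', pow_char_eq_expand p hK]
      split_ifs with hle
      · refine PowerSeries.coeff_expand_of_not_dvd _ _ _ fun h => hne ?_
        rw [← (Nat.modEq_iff_dvd' hle).2 h, Nat.mod_eq_of_lt (Finset.mem_range.1 hr)]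
      · rfl
    · exact fun h => absurd (Finset.mem_range.2 (Nat.mod_lt m hpos)) h
  obtain ⟨n, a, ha, hsum⟩ := exists_additive_equation p f M hf t₀
  obtain ⟨n, a, ha, hsum⟩ := exists_separable_additive_equation p hK (f t₀) n a ha hsum
  exact isRationalResidue_of_additive_equation p a n ha (f t₀) hsum

theorem theorem2 {p : ℕ} [Fact p.Prime] {A : Type*} [Finite A] (u : Config ℕ A)
    (hu : IsAutomatic p u) :
    ∃ k d : ℕ, 1 ≤ k ∧ 1 ≤ d ∧
      ∃ Φ : Config ℤ (Fin d → GaloisField p k) → Config ℤ (Fin d → GaloisField p k),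
        IsLinearCellularAutomaton (GaloisField p k) Φ ∧
        ∃ (R₀ : Config ℤ (Fin d → GaloisField p k)) (Y : Subsystem Φ),
          IsEventuallyPeriodic R₀ ∧
          Y.carrier = orbitClosure Φ R₀ ∧
          IsTopologicalFactor (subshift u).map Y.map := by
  classical
  -- The prime field, `k = 1`, suffices.
  have hK (c : GaloisField p 1) : c ^ p = c := by
    have : Fintype (GaloisField p 1) := Fintype.ofFinite _
    have hcard : Fintype.card (GaloisField p 1) = p := by
      rw [← Nat.card_eq_fintype_card, GaloisField.card p 1 one_ne_zero, pow_one]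
    simpa only [hcard] using FiniteField.pow_card c
  obtain ⟨J, Φ, R₀, ℓ, s, hΦ, hR₀, hs, hℓ⟩ := exists_linearCA_of_isRationalResidue
    (fun c : A => PowerSeries.mk fun n => if u n = c then (1 : GaloisField p 1) else 0)
    fun c => hu.isRationalResidue hK c
  have hdecode : Function.Injective fun a c : A => if a = c then (1 : GaloisField p 1) else 0 := by
    intro a b hab
    have := congrFun hab b
    by_contra hne
    simp [hne] at this
  have : Nonempty A := ⟨u 0⟩
  -- Letters are decoded from their indicator vectors; the value of `Function.invFun` at other
  -- vectors is irrelevant.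
  obtain ⟨Y, hY, hfactor⟩ := exists_isTopologicalFactor_subshift hΦ.continuous R₀
    (fun R => Function.invFun (fun a c : A => if a = c then (1 : GaloisField p 1) else 0)
      fun c => ℓ c R) s
    (fun R R' h => by simp only [fun c => hs c R R' h]) u fun n => by
      simp only [hℓ, PowerSeries.coeff_mk]
      exact Function.leftInverse_invFun hdecode (u n)
  exact ⟨1, J + 1, le_rfl, by omega, Φ, hΦ, R₀, Y, hR₀, hY, hfactor⟩
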